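/- Let $(M_n)_{n\ge 0}$ be a weight sequence, that is, a sequence of positive real numbers with $M_0=1$ and $\frac{M_{n+m}}{M_nM_m}\ge\binom{n+m}{n}$ for all integers $m,n\ge 0$, and let \[D([0,1],M)=\Big\{f\in C^\infty([0,1],\mathbb C):\ \|f\|_D=\sum_{n=0}^\infty\frac{\|f^{(n)}\|_\infty}{M_n}<\infty\Big\},\] an algebra under pointwise operations, normed by $\|\cdot\|_D$ (derivatives at the end points of $[0,1]$ are one-sided, and $\|\cdot\|_\infty$ is the supremum norm on $[0,1]$). Suppose that $\varphi:[0,1]\to[0,1]$ induces a compact endomorphism $T$ of $D([0,1],M)$, that is, $Tf=f\circ\varphi$ defines an algebra endomorphism of $D([0,1],M)$ which is a compact operator. Then $\varphi$ has exactly one fixed point $x_0$, and the spectrum of $T$ as a bounded linear operator on $D([0,1],M)$ is \[\sigma(T)=\{\varphi'(x_0)^n:\ n\ge 1\}\cup\{0,1\}.\] -/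

import Mathlib

open scoped ContDiff

noncomputable section

namespace DalesDavie

/-- A weight sequence: positive reals with `M 0 = 1` and
`M (n + m) / (M n * M m) ≥ (n + m).choose n` for all `m, n`. -/
structure WeightSequence where
  /-- The underlying sequence. -/
  toFun : ℕ → ℝ
  pos : ∀ n, 0 < toFun n
  map_zero : toFun 0 = 1
  choose_le : ∀ m n, ((n + m).choose n : ℝ) ≤ toFun (n + m) / (toFun n * toFun m)

instance : CoeFun WeightSequence (fun _ => ℕ → ℝ) := ⟨WeightSequence.toFun⟩

/-- A function on `[0,1]` viewed as a function on `ℝ` (constant outside `[0,1]`). Only its values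
on `[0,1]` matter below, because every derivative is taken within `[0,1]`. -/
def ext {E : Type*} (f : unitInterval → E) : ℝ → E :=
  Set.IccExtend (zero_le_one : (0 : ℝ) ≤ 1) f

/-- The `n`-th derivative of `f : [0,1] → ℂ` (one-sided at the end points). -/
def nthDeriv (n : ℕ) (f : unitInterval → ℂ) (x : unitInterval) : ℂ :=
  iteratedDerivWithin n (ext f) (Set.Icc 0 1) (x : ℝ)

/-- Infinite differentiability on `[0,1]`. -/
def IsSmooth (f : unitInterval → ℂ) : Prop :=
  ContDiffOn ℝ ∞ (ext f) (Set.Icc 0 1)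

/-- The supremum norm `‖f⁽ⁿ⁾‖_∞` over `[0,1]`. -/
def supDeriv (n : ℕ) (f : unitInterval → ℂ) : ℝ :=
  ⨆ x : unitInterval, ‖nthDeriv n f x‖

/-- Membership in `D([0,1],M)`. -/
def MemD (M : WeightSequence) (f : unitInterval → ℂ) : Prop :=
  IsSmooth f ∧ Summable (fun n => supDeriv n f / M n)

/-- The derivative of a self-map of `[0,1]` (one-sided at the end points). -/
def selfMapDeriv (φ : unitInterval → unitInterval) (x : unitInterval) : ℝ :=
  derivWithin (ext (fun t => (φ t : ℝ))) (Set.Icc 0 1) (x : ℝ)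

theorem bddAbove_nthDeriv {f : unitInterval → ℂ} (hf : IsSmooth f) (n : ℕ) :
    BddAbove (Set.range fun x : unitInterval => ‖nthDeriv n f x‖) := by
  have h := (ContDiffOn.continuousOn_iteratedDerivWithin hf (m := n)
    (by exact_mod_cast le_top) (uniqueDiffOn_Icc zero_lt_one)).norm
  obtain ⟨C, hC⟩ := isCompact_Icc.bddAbove_image h
  refine ⟨C, ?_⟩
  rintro _ ⟨x, rfl⟩
  exact hC ⟨x, x.2, rfl⟩

theorem le_supDeriv {f : unitInterval → ℂ} (hf : IsSmooth f) (n : ℕ) (x : unitInterval) :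
    ‖nthDeriv n f x‖ ≤ supDeriv n f :=
  le_ciSup (bddAbove_nthDeriv hf n) x

theorem supDeriv_nonneg (n : ℕ) (f : unitInterval → ℂ) : 0 ≤ supDeriv n f :=
  Real.iSup_nonneg fun _ => norm_nonneg _

theorem IsSmooth.add {f g : unitInterval → ℂ} (hf : IsSmooth f) (hg : IsSmooth g) :
    IsSmooth (f + g) :=
  ContDiffOn.add hf hg

theorem IsSmooth.mul {f g : unitInterval → ℂ} (hf : IsSmooth f) (hg : IsSmooth g) :
    IsSmooth (f * g) :=
  ContDiffOn.mul hf hg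

theorem IsSmooth.const (c : ℂ) : IsSmooth (fun _ => c) :=
  contDiffOn_const (c := c)

theorem IsSmooth.contDiffWithinAt {f : unitInterval → ℂ} (hf : IsSmooth f) (n : ℕ)
    (x : unitInterval) : ContDiffWithinAt ℝ n (ext f) (Set.Icc 0 1) (x : ℝ) :=
  (ContDiffOn.of_le hf (by exact_mod_cast le_top)) x x.2

theorem supDeriv_add_le {f g : unitInterval → ℂ} (hf : IsSmooth f) (hg : IsSmooth g) (n : ℕ) :
    supDeriv n (f + g) ≤ supDeriv n f + supDeriv n g := by
  refine ciSup_le fun x => ?_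
  have h : nthDeriv n (f + g) x = nthDeriv n f x + nthDeriv n g x :=
    iteratedDerivWithin_add x.2 (uniqueDiffOn_Icc zero_lt_one)
      (hf.contDiffWithinAt n x) (hg.contDiffWithinAt n x)
  rw [h]
  exact (norm_add_le _ _).trans (add_le_add (le_supDeriv hf n x) (le_supDeriv hg n x))

theorem supDeriv_smul (c : ℂ) (f : unitInterval → ℂ) (n : ℕ) :
    supDeriv n (c • f) = ‖c‖ * supDeriv n f := by
  have h : ∀ x, nthDeriv n (c • f) x = c • nthDeriv n f x := fun x =>
    iteratedDerivWithin_const_smul_field c (ext f)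
  simp only [supDeriv, h, norm_smul]
  exact (Real.mul_iSup_of_nonneg (norm_nonneg c) _).symm

theorem supDeriv_mul_le {f g : unitInterval → ℂ} (hf : IsSmooth f) (hg : IsSmooth g) (n : ℕ) :
    supDeriv n (f * g) ≤
      ∑ i ∈ Finset.range (n + 1), (n.choose i : ℝ) * supDeriv i f * supDeriv (n - i) g := by
  refine ciSup_le fun x => ?_
  have h := norm_iteratedFDerivWithin_mul_le (n := n) hf hg (uniqueDiffOn_Icc zero_lt_one) x.2
    (by exact_mod_cast le_top)
  simp only [norm_iteratedFDerivWithin_eq_norm_iteratedDerivWithin] at h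
  refine h.trans (Finset.sum_le_sum fun i _ => ?_)
  have h1 := le_supDeriv hf i x
  have h2 := le_supDeriv hg (n - i) x
  have h3 := supDeriv_nonneg i f
  simp only [nthDeriv] at h1 h2
  gcongr

theorem supDeriv_mul_div_le (M : WeightSequence) {f g : unitInterval → ℂ} (hf : IsSmooth f)
    (hg : IsSmooth g) (n : ℕ) :
    supDeriv n (f * g) / M n ≤
      ∑ i ∈ Finset.range (n + 1), supDeriv i f / M i * (supDeriv (n - i) g / M (n - i)) := by
  rw [div_le_iff₀ (M.pos n), Finset.sum_mul]
  refine (supDeriv_mul_le hf hg n).trans (Finset.sum_le_sum fun i hi => ?_)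
  have hin : i + (n - i) = n := by have := Finset.mem_range.1 hi; omega
  have hc := M.choose_le (n - i) i
  rw [hin] at hc
  have h1 := supDeriv_nonneg i f
  have h2 := supDeriv_nonneg (n - i) g
  calc (n.choose i : ℝ) * supDeriv i f * supDeriv (n - i) g
      = (n.choose i : ℝ) * (supDeriv i f * supDeriv (n - i) g) := by ring
    _ ≤ M n / (M i * M (n - i)) * (supDeriv i f * supDeriv (n - i) g) := by gcongr
    _ = supDeriv i f / M i * (supDeriv (n - i) g / M (n - i)) * M n := by
      have := (M.pos i).ne'
      have := (M.pos (n - i)).ne'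
      field_simp

theorem div_nonneg' (M : WeightSequence) (f : unitInterval → ℂ) (n : ℕ) :
    0 ≤ supDeriv n f / M n :=
  div_nonneg (supDeriv_nonneg n f) (M.pos n).le

theorem MemD.add {M : WeightSequence} {f g : unitInterval → ℂ} (hf : MemD M f) (hg : MemD M g) :
    MemD M (f + g) := by
  refine ⟨hf.1.add hg.1, Summable.of_nonneg_of_le (div_nonneg' M _) (fun n => ?_)
    (hf.2.add hg.2)⟩
  rw [← add_div]
  exact div_le_div_of_nonneg_right (supDeriv_add_le hf.1 hg.1 n) (M.pos n).le

theorem summable_cauchy {M : WeightSequence} {f g : unitInterval → ℂ} (hf : MemD M f)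
    (hg : MemD M g) :
    Summable (fun n => ∑ i ∈ Finset.range (n + 1),
      supDeriv i f / M i * (supDeriv (n - i) g / M (n - i))) :=
  summable_sum_mul_range_of_summable_norm' (f := fun i => supDeriv i f / M i)
    (g := fun i => supDeriv i g / M i) hf.2.norm hf.2 hg.2.norm hg.2

theorem MemD.mul {M : WeightSequence} {f g : unitInterval → ℂ} (hf : MemD M f) (hg : MemD M g) :
    MemD M (f * g) :=
  ⟨hf.1.mul hg.1, Summable.of_nonneg_of_le (div_nonneg' M _)
    (supDeriv_mul_div_le M hf.1 hg.1) (summable_cauchy hf hg)⟩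

theorem MemD.const (M : WeightSequence) (c : ℂ) : MemD M (fun _ => c) := by
  refine ⟨IsSmooth.const c, summable_of_ne_finset_zero (s := {0}) fun n hn => ?_⟩
  have hn' : n ≠ 0 := by simpa using hn
  have h : ∀ x, nthDeriv n (fun _ => c) x = 0 := fun x => by
    have : ext (fun _ : unitInterval => c) = fun _ => c := rfl
    simp [nthDeriv, this, iteratedDerivWithin_const, hn']
  simp [supDeriv, h]

/-- `D([0,1],M)` as a subalgebra of the algebra of all functions `[0,1] → ℂ`. -/
def subalg (M : WeightSequence) : Subalgebra ℂ (unitInterval → ℂ) where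
  carrier := {f | MemD M f}
  mul_mem' hf hg := MemD.mul hf hg
  add_mem' hf hg := MemD.add hf hg
  algebraMap_mem' c := MemD.const M c

/-- The algebra `D([0,1],M)`, as a type of its own: its topology is that of the norm below, not
that of pointwise convergence. -/
def D (M : WeightSequence) : Type := subalg M

namespace D

variable {M : WeightSequence}

instance : CommRing (D M) := inferInstanceAs (CommRing (subalg M))

instance : Algebra ℂ (D M) := inferInstanceAs (Algebra ℂ (subalg M))

instance : CoeFun (D M) (fun _ => unitInterval → ℂ) := ⟨Subtype.val⟩

theorem memD (f : D M) : MemD M f := f.2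

/-- `‖f‖_D = ∑ₙ ‖f⁽ⁿ⁾‖_∞ / Mₙ`. -/
instance : Norm (D M) := ⟨fun f => ∑' n, supDeriv n f / M n⟩

theorem norm_def (f : D M) : ‖f‖ = ∑' n, supDeriv n f / M n := rfl

theorem norm_smul_eq (c : ℂ) (f : D M) : ‖c • f‖ = ‖c‖ * ‖f‖ := by
  rw [norm_def, norm_def, ← tsum_mul_left]
  refine tsum_congr fun n => ?_
  have h : supDeriv n (c • f : D M) = ‖c‖ * supDeriv n f := supDeriv_smul c f n
  rw [h, mul_div_assoc]

theorem norm_add_le' (f g : D M) : ‖f + g‖ ≤ ‖f‖ + ‖g‖ := by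
  rw [norm_def, norm_def, norm_def, ← f.memD.2.tsum_add g.memD.2]
  refine (f + g).memD.2.tsum_le_tsum (fun n => ?_) (f.memD.2.add g.memD.2)
  rw [← add_div]
  exact div_le_div_of_nonneg_right (supDeriv_add_le f.memD.1 g.memD.1 n) (M.pos n).le

theorem norm_mul_le' (f g : D M) : ‖f * g‖ ≤ ‖f‖ * ‖g‖ := by
  rw [norm_def, norm_def, norm_def,
    tsum_mul_tsum_eq_tsum_sum_range_of_summable_norm f.memD.2.norm g.memD.2.norm]
  exact (f * g).memD.2.tsum_le_tsum (supDeriv_mul_div_le M f.memD.1 g.memD.1)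
    (summable_cauchy f.memD g.memD)

theorem norm_apply_le (f : D M) (x : unitInterval) : ‖f x‖ ≤ ‖f‖ := by
  have h0 : nthDeriv 0 f x = f x := by simp [nthDeriv, ext]
  have h1 := le_supDeriv f.memD.1 0 x
  have h2 : supDeriv 0 f / M 0 ≤ ‖f‖ := f.memD.2.le_tsum 0 fun n _ => div_nonneg' M f n
  rw [M.map_zero, div_one] at h2
  rw [← h0]
  exact h1.trans h2

/-- `‖·‖_D` is an additive group norm. -/
def addGroupNorm (M : WeightSequence) : AddGroupNorm (D M) where
  toFun f := ‖f‖
  map_zero' := by simpa using norm_smul_eq (0 : ℂ) (0 : D M)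
  add_le' := norm_add_le'
  neg' f := by simpa using norm_smul_eq (-1 : ℂ) f
  eq_zero_of_map_eq_zero' f hf := by
    refine Subtype.ext (funext fun x => ?_)
    have h := norm_apply_le f x
    rw [hf] at h
    exact norm_le_zero_iff.1 h

instance : NormedCommRing (D M) :=
  { (addGroupNorm M).toNormedAddCommGroup, (inferInstance : CommRing (D M)) with
    toNorm := inferInstance
    norm_mul_le := norm_mul_le' }

instance : NormedAlgebra ℂ (D M) where
  norm_smul_le c f := (norm_smul_eq c f).le

end D

end DalesDavie

end

/-! At a fixed point c of φ, let V_n be the closed subspace of functions whose derivatives of order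
below n vanish at c. By the chain rule T acts on V_n / V_{n+1} as multiplication by φ'(c)^n
(`sub_smul_mem_vanishing`). A compact operator cannot act on such a strictly decreasing chain by
scalars bounded away from 0, so |φ'(c)| < 1 at every fixed point (`abs_selfMapDeriv_lt_one`). Since
φ cannot cross the diagonal twice with slope below 1, the fixed point is unique.

Each φ'(c)^n lies in the spectrum because T is triangular on the finite-dimensional quotient by
V_{n+1} (`pow_mem_spectrum`). Conversely, a nonzero spectral value μ is an eigenvalue
(`hasEigenvalue_of_mem_spectrum`, proved without using completeness). If some derivative of an
eigenfunction f is nonzero at c, the first such derivative forces μ = φ'(c)^n. If f is flat at c,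
iterating the contraction φ shows that f vanishes near c. The component of the zero set around c is
then shown to be all of [0,1], because φ has no 2-cycles: `fixedPoint_unique` also applies to the
compact T ∘ T. So f = 0, a contradiction. -/

namespace DalesDavie

/-! ### Riesz theory of compact operators without completeness -/

section Compact

open Filter Topology

variable {X : Type*} [NormedAddCommGroup X] [NormedSpace ℂ X]

/-- A compact operator cannot act on a strictly decreasing chain of closed subspaces by scalars
bounded away from zero modulo the next member of the chain. -/
theorem false_of_isCompactOperator_of_chain {T : X →L[ℂ] X} (hT : IsCompactOperator T)
    {E : ℕ → Submodule ℂ X} (hclosed : ∀ n, IsClosed (E n : Set X)) (hE : ∀ n, E (n + 1) < E n)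
    {δ : ℝ} (hδ : 0 < δ)
    (h : ∀ n, ∃ ν : ℂ, δ ≤ ‖ν‖ ∧ ∀ f ∈ E n, T f - ν • f ∈ E (n + 1)) : False := by
  have hanti : Antitone E := antitone_nat_of_succ_le fun n => (hE n).le
  have hmap : ∀ n, ∀ f ∈ E n, T f ∈ E n := fun n f hf => by
    obtain ⟨ν, -, hν⟩ := h n
    have := (E n).add_mem ((hE n).le (hν f hf)) ((E n).smul_mem ν hf)
    simpa using this
  -- Riesz's lemma for E (n + 1) inside E n; the bound 3 only has to exceed the norm of the
  -- auxiliary scalar 2.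
  have hx : ∀ n, ∃ x ∈ E n, ‖x‖ ≤ 3 ∧ ∀ y ∈ E (n + 1), 1 ≤ ‖x - y‖ := fun n => by
    have h₁ : IsClosed ((E (n + 1)).comap (E n).subtype : Set (E n)) :=
      (hclosed (n + 1)).preimage continuous_subtype_val
    have h₂ : ∃ x : E n, x ∉ (E (n + 1)).comap (E n).subtype := by
      obtain ⟨x, hx, hx'⟩ := SetLike.exists_of_lt (hE n)
      exact ⟨⟨x, hx⟩, hx'⟩
    obtain ⟨x, hxn, hxy⟩ := riesz_lemma_of_norm_lt (c := (2 : ℂ)) (R := 3) (by simp)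
      (by norm_num) h₁ h₂
    exact ⟨x, x.2, hxn, fun y hy => hxy ⟨y, (hE n).le hy⟩ hy⟩
  choose x hxE hxn hxy using hx
  have hsep : ∀ n m, n < m → δ ≤ ‖T (x n) - T (x m)‖ := fun n m hnm => by
    obtain ⟨ν, hνδ, hν⟩ := h n
    have hν0 : ν ≠ 0 := norm_pos_iff.1 (hδ.trans_le hνδ)
    have hmem : T (x m) - (T (x n) - ν • x n) ∈ E (n + 1) :=
      (E (n + 1)).sub_mem (hanti hnm (hmap m _ (hxE m))) (hν _ (hxE n))
    have h1 := hxy n _ ((E (n + 1)).smul_mem ν⁻¹ hmem)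
    have h2 : T (x n) - T (x m) = ν • (x n - ν⁻¹ • (T (x m) - (T (x n) - ν • x n))) := by
      rw [smul_sub, smul_inv_smul₀ hν0]
      abel
    rw [h2, norm_smul]
    nlinarith [norm_nonneg ν]
  have hcpt := hT.isCompact_closure_image_closedBall (f := (T : X →ₗ[ℂ] X)) 3
  obtain ⟨z, -, k, hk, hz⟩ := hcpt.tendsto_subseq (x := fun n => T (x n)) fun n =>
    subset_closure ⟨x n, by simpa using hxn n, rfl⟩
  obtain ⟨N, hN⟩ := Metric.cauchySeq_iff.1 hz.cauchySeq δ hδ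
  have h1 := hN N le_rfl (N + 1) (Nat.le_succ N)
  rw [dist_eq_norm] at h1
  exact (hsep _ _ (hk (Nat.lt_succ_self N))).not_gt h1

/-- For a compact operator `T` and `μ ≠ 0`, a bounded below `T - μ` is a closed map, even when the
space is not complete. -/
theorem isClosedMap_sub_smul_one {T : X →L[ℂ] X} (hT : IsCompactOperator T) {μ : ℂ} (hμ : μ ≠ 0)
    {K : NNReal} (hK : AntilipschitzWith K (T - μ • 1 : X →L[ℂ] X)) :
    IsClosedMap (T - μ • 1 : X →L[ℂ] X) := by
  intro C hC
  refine IsSeqClosed.isClosed fun u y hu hy => ?_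
  choose x hxC hx using hu
  -- The images converge, hence are bounded, and the lower bound on T - μ transfers this to the
  -- preimages. Compactness of T then yields convergence along a subsequence, since x = μ⁻¹ (T x -
  -- (T - μ) x).
  have hbdd : ∃ R, ∀ n, ‖x n‖ ≤ R := by
    obtain ⟨R, hR⟩ := hy.norm.bddAbove_range
    refine ⟨K * R, fun n => ?_⟩
    have h1 := hK.le_mul_dist (x n) 0
    rw [map_zero, dist_zero_right, dist_zero_right, hx n] at h1
    exact h1.trans (mul_le_mul_of_nonneg_left (hR ⟨n, rfl⟩) K.2)
  obtain ⟨R, hR⟩ := hbdd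
  have hcpt := hT.isCompact_closure_image_closedBall (f := (T : X →ₗ[ℂ] X)) R
  obtain ⟨z, -, k, hk, hz⟩ := hcpt.tendsto_subseq (x := fun n => T (x n)) fun n =>
    subset_closure ⟨x n, by simpa using hR n, rfl⟩
  have hxk : Tendsto (fun n => x (k n)) atTop (𝓝 (μ⁻¹ • (z - y))) := by
    have h1 := (hz.sub (hy.comp hk.tendsto_atTop)).const_smul μ⁻¹
    refine h1.congr fun n => ?_
    simp only [Function.comp, ← hx]
    simp [hμ]
  refine ⟨_, hC.mem_of_tendsto hxk (Eventually.of_forall fun n => hxC _), ?_⟩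
  have h1 := ((T - μ • 1 : X →L[ℂ] X).continuous.tendsto _).comp hxk
  refine tendsto_nhds_unique h1 ((hy.comp hk.tendsto_atTop).congr fun n => ?_)
  exact (hx (k n)).symm

/-- The Fredholm alternative for a compact operator on a possibly incomplete normed space. -/
theorem hasEigenvalue_of_mem_spectrum {T : X →L[ℂ] X} (hT : IsCompactOperator T) {μ : ℂ}
    (hμ : μ ≠ 0) (hσ : μ ∈ spectrum ℂ T) :
    Module.End.HasEigenvalue (T : Module.End ℂ X) μ := by
  by_contra hne
  obtain ⟨K, hK⟩ := hT.antilipschitz_of_not_hasEigenvalue hμ hne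
  have hcm := isClosedMap_sub_smul_one hT hμ hK
  set S : X →L[ℂ] X := T - μ • 1 with hS
  -- If S is injective but not onto, the ranges of its powers form a strictly decreasing closed
  -- chain, on which T = μ + S acts as μ modulo the next range.
  have hsurj : Function.Surjective S := by
    by_contra hns
    refine false_of_isCompactOperator_of_chain hT
      (E := fun n => LinearMap.range ((S : Module.End ℂ X) ^ n)) (fun n => ?_) (fun n => ?_)
      (norm_pos_iff.2 hμ) (fun n => ⟨μ, le_rfl, ?_⟩)
    · induction n with
      | zero => simp [Module.End.one_eq_id]
      | succ n ih =>
        have := hcm _ ih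
        rw [pow_succ', Module.End.mul_eq_comp, LinearMap.range_comp]
        exact this
    · refine lt_of_le_of_ne ?_ fun heq => hns fun y => ?_
      · rw [pow_succ, Module.End.mul_eq_comp]
        exact LinearMap.range_comp_le_range _ _
      · have hy : ((S : Module.End ℂ X) ^ n) y ∈ LinearMap.range ((S : Module.End ℂ X) ^ n) :=
          ⟨y, rfl⟩
        rw [← heq] at hy
        obtain ⟨w, hw⟩ := hy
        rw [pow_succ, Module.End.mul_apply] at hw
        have hinj : Function.Injective ((S : Module.End ℂ X) ^ n) := by
          rw [Module.End.coe_pow]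
          exact hK.injective.iterate n
        exact ⟨w, hinj hw⟩
    · rintro f ⟨g, rfl⟩
      refine ⟨g, ?_⟩
      rw [pow_succ', Module.End.mul_apply]
      simp [hS]
  let e : X ≃ₗ[ℂ] X := LinearEquiv.ofBijective (S : X →ₗ[ℂ] X) ⟨hK.injective, hsurj⟩
  -- The lower bound on S makes the inverse Lipschitz, so no open mapping theorem is needed.
  have hcont : Continuous e.symm :=
    (hK.to_rightInverse (g := e.symm) fun y => e.apply_symm_apply y).continuous
  let e' : X ≃L[ℂ] X := ⟨e, S.continuous, hcont⟩
  have hunit : IsUnit S := ⟨ContinuousLinearEquiv.toUnit e', rfl⟩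
  refine hσ ?_
  have : algebraMap ℂ (X →L[ℂ] X) μ - T = -S := by
    rw [hS, Algebra.algebraMap_eq_smul_one, neg_sub]
  rw [spectrum.mem_resolventSet_iff, this]
  exact hunit.neg

end Compact

end DalesDavie

namespace DalesDavie

/-! ### Derivatives of compositions at a fixed point -/

section Calculus

open Set

theorem ext_apply {E : Type*} (f : unitInterval → E) {t : ℝ} (ht : t ∈ Icc (0 : ℝ) 1) :
    ext f t = f ⟨t, ht⟩ :=
  IccExtend_of_mem _ _ ht

/-- If the derivatives of `F` of order less than `n` vanish at a fixed point `c` of `Φ`, then the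
`n`-th derivative of `F ∘ Φ` at `c` is `Φ'(c) ^ n * F⁽ⁿ⁾(c)`. -/
theorem iteratedDerivWithin_comp_of_fixed {Φ : ℝ → ℝ} {s : Set ℝ} (hs : UniqueDiffOn ℝ s)
    (hΦ : ContDiffOn ℝ ∞ Φ s) (hmap : MapsTo Φ s s) {c : ℝ} (hc : c ∈ s) (hfix : Φ c = c)
    (n : ℕ) {F : ℝ → ℂ} (hF : ContDiffOn ℝ ∞ F s)
    (h0 : ∀ k < n, iteratedDerivWithin k F s c = 0) :
    iteratedDerivWithin n (F ∘ Φ) s c =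
      ((derivWithin Φ s c : ℝ) : ℂ) ^ n * iteratedDerivWithin n F s c := by
  induction n using Nat.strong_induction_on generalizing F with
  | _ n ih =>
  rcases n with _ | n
  · simp [hfix]
  have hF' : ContDiffOn ℝ ∞ (derivWithin F s) s := hF.derivWithin hs (by simp)
  have hΦ' : ContDiffOn ℝ ∞ (derivWithin Φ s) s := hΦ.derivWithin hs (by simp)
  have hΦ'' : ContDiffOn ℝ ∞ (fun x => ((derivWithin Φ s x : ℝ) : ℂ)) s :=
    Complex.ofRealCLM.contDiff.comp_contDiffOn hΦ'
  have heq : EqOn (derivWithin (F ∘ Φ) s)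
      ((derivWithin F s ∘ Φ) * fun x => ((derivWithin Φ s x : ℝ) : ℂ)) s := fun x hx => by
    rw [derivWithin.scomp x (hF.differentiableOn (by simp) _ (hmap hx))
      (hΦ.differentiableOn (by simp) _ hx) hmap]
    simp [mul_comm]
  -- Leibniz applied to (F' ∘ Φ) · Φ'. By induction on the order, the i-th derivative of F' ∘ Φ at c
  -- is a multiple of F⁽ⁱ⁺¹⁾(c), which is zero for i < n.
  rw [iteratedDerivWithin_succ', iteratedDerivWithin_congr heq hc,
    iteratedDerivWithin_mul hc hs
      (((hF'.comp hΦ hmap).of_le (by exact_mod_cast le_top)) c hc)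
      ((hΦ''.of_le (by exact_mod_cast le_top)) c hc), Finset.sum_eq_single n]
  · rw [ih n (Nat.lt_succ_self n) hF' fun k hk => by
      rw [← iteratedDerivWithin_succ']; exact h0 _ (Nat.succ_lt_succ hk)]
    rw [← iteratedDerivWithin_succ']
    simp only [Nat.choose_self, Nat.cast_one, one_mul, Nat.sub_self, iteratedDerivWithin_zero]
    ring
  · intro i hi hin
    have hi' : i < n := lt_of_le_of_ne (Nat.lt_succ_iff.1 (Finset.mem_range.1 hi)) hin
    rw [ih i (hi'.trans (Nat.lt_succ_self n)) hF' fun k hk => by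
      rw [← iteratedDerivWithin_succ']; exact h0 _ (Nat.succ_lt_succ (hk.trans hi'))]
    rw [← iteratedDerivWithin_succ', h0 _ (Nat.succ_lt_succ hi')]
    simp
  · intro h
    exact absurd (Finset.mem_range.2 (Nat.lt_succ_self n)) h

theorem isSmooth_coe_sub (c : ℂ) : IsSmooth fun x : unitInterval => ((x : ℝ) : ℂ) - c := by
  have h : ContDiffOn ℝ ∞ (fun t : ℝ => (t : ℂ) - c) (Icc 0 1) :=
    (Complex.ofRealCLM.contDiff.sub contDiff_const).contDiffOn
  exact h.congr fun t ht => ext_apply _ ht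

theorem nthDeriv_coe_sub_succ (c : ℂ) (n : ℕ) (x : unitInterval) :
    nthDeriv (n + 1) (fun x : unitInterval => ((x : ℝ) : ℂ) - c) x = if n = 0 then 1 else 0 := by
  have heq : EqOn (derivWithin (ext fun x : unitInterval => ((x : ℝ) : ℂ) - c) (Icc 0 1))
      (fun _ => 1) (Icc 0 1) := fun t ht => by
    have h : HasDerivAt (fun t : ℝ => (t : ℂ) - c) 1 t :=
      (Complex.ofRealCLM.hasDerivAt (x := t)).sub_const c
    exact (h.hasDerivWithinAt.congr (fun y hy => ext_apply _ hy)
      (ext_apply _ ht)).derivWithin (uniqueDiffOn_Icc zero_lt_one t ht)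
  rw [nthDeriv, iteratedDerivWithin_succ', iteratedDerivWithin_congr heq x.2,
    iteratedDerivWithin_const]

theorem memD_coe_sub (M : WeightSequence) (c : ℂ) :
    MemD M fun x : unitInterval => ((x : ℝ) : ℂ) - c := by
  refine ⟨isSmooth_coe_sub c, summable_of_ne_finset_zero (s := {0, 1}) fun n hn => ?_⟩
  simp only [Finset.mem_insert, Finset.mem_singleton, not_or] at hn
  obtain ⟨m, rfl⟩ := Nat.exists_eq_succ_of_ne_zero hn.1
  have hm : m ≠ 0 := fun h => hn.2 (by rw [h])
  simp [supDeriv, nthDeriv_coe_sub_succ, hm]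

theorem nthDeriv_zero (f : unitInterval → ℂ) (x : unitInterval) : nthDeriv 0 f x = f x := by
  rw [nthDeriv, iteratedDerivWithin_zero, ext_apply f x.2]

end Calculus

/-! ### The filtration by order of vanishing at a point -/

namespace D

variable {M : WeightSequence}

/-- The function `x ↦ x - c` as an element of `D([0,1],M)`. -/
noncomputable def coeSub (M : WeightSequence) (c : ℂ) : D M :=
  ⟨fun x => ((x : ℝ) : ℂ) - c, memD_coe_sub M c⟩

theorem coeSub_apply (c : ℂ) (x : unitInterval) : coeSub M c x = ((x : ℝ) : ℂ) - c := rfl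

/-- The functional `f ↦ f⁽ⁿ⁾(c)` on `D([0,1],M)`. -/
noncomputable def derivAt (c : unitInterval) (n : ℕ) : D M →L[ℂ] ℂ :=
  LinearMap.mkContinuous
    { toFun := fun f => nthDeriv n f c
      map_add' := fun f g => iteratedDerivWithin_add c.2 (uniqueDiffOn_Icc zero_lt_one)
        (f.memD.1.contDiffWithinAt n c) (g.memD.1.contDiffWithinAt n c)
      map_smul' := fun z f => iteratedDerivWithin_const_smul_field z (ext f) }
    (M n) fun f => by
      have h1 : supDeriv n f / M n ≤ ‖f‖ := f.memD.2.le_tsum n fun k _ => div_nonneg' M f k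
      rw [div_le_iff₀' (M.pos n)] at h1
      exact (le_supDeriv f.memD.1 n c).trans h1

theorem derivAt_apply (c : unitInterval) (n : ℕ) (f : D M) : derivAt c n f = nthDeriv n f c :=
  rfl

theorem derivAt_zero (c : unitInterval) (f : D M) : derivAt c 0 f = f c :=
  nthDeriv_zero f c

theorem derivAt_zero_coeSub_mul (c : unitInterval) (f : D M) :
    derivAt c 0 (coeSub M c * f) = 0 := by
  rw [derivAt_zero]
  change (((c : ℝ) : ℂ) - c) * f c = 0
  simp

theorem derivAt_succ_coeSub_mul (c : unitInterval) (n : ℕ) (f : D M) :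
    derivAt c (n + 1) (coeSub M c * f) = (n + 1) * derivAt c n f := by
  have h : derivAt c (n + 1) (coeSub M c * f) = ∑ i ∈ Finset.range (n + 1 + 1),
      ((n + 1).choose i : ℂ) * nthDeriv i (coeSub M c) c * nthDeriv (n + 1 - i) f c :=
    iteratedDerivWithin_mul c.2 (uniqueDiffOn_Icc zero_lt_one)
      ((isSmooth_coe_sub c).contDiffWithinAt (n + 1) c) (f.memD.1.contDiffWithinAt (n + 1) c)
  rw [h, Finset.sum_eq_single 1]
  · have h1 : nthDeriv 1 (coeSub M c) c = 1 :=
      (nthDeriv_coe_sub_succ c 0 c).trans (if_pos rfl)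
    simp [h1, derivAt_apply]
  · intro i _ hi
    rcases i with _ | i
    · simp [nthDeriv_zero, coeSub_apply]
    · have h1 : nthDeriv (i + 1) (coeSub M c) c = 0 := 
        (nthDeriv_coe_sub_succ c i c).trans (if_neg fun h => hi (by rw [h]))
      simp [h1]
  · intro h1
    exact absurd (Finset.mem_range.2 (by omega)) h1

/-- Up to factorials, the powers of x - c are dual to the derivative functionals at c; this makes
the filtration strictly decreasing. -/
theorem derivAt_coeSub_pow (c : unitInterval) (n k : ℕ) :
    derivAt c k (coeSub M c ^ n) = if k = n then (n.factorial : ℂ) else 0 := by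
  induction n generalizing k with
  | zero =>
    rw [pow_zero]
    rcases k with _ | k
    · rw [derivAt_zero]
      simp only [Nat.factorial_zero, Nat.cast_one, if_true]
      rfl
    · have : derivAt c (k + 1) (1 : D M) =
          iteratedDerivWithin (k + 1) (fun _ => (1 : ℂ)) (Set.Icc (0 : ℝ) 1) (c : ℝ) := rfl
      rw [this, iteratedDerivWithin_const]
      simp
  | succ n ih =>
    rw [pow_succ']
    rcases k with _ | k
    · rw [derivAt_zero_coeSub_mul]
      simp
    · rw [derivAt_succ_coeSub_mul, ih]
      by_cases h : k = n
      · simp [h, Nat.factorial_succ]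
      · simp [h]

/-- The closed ideal of functions whose derivatives of order less than `n` vanish at `c`, as a
subspace. -/
noncomputable def vanishing (M : WeightSequence) (c : unitInterval) (n : ℕ) :
    Submodule ℂ (D M) :=
  ⨅ k : Fin n, LinearMap.ker (derivAt (M := M) c k : D M →ₗ[ℂ] ℂ)

theorem mem_vanishing {c : unitInterval} {n : ℕ} {f : D M} :
    f ∈ vanishing M c n ↔ ∀ k < n, derivAt c k f = 0 := by
  simp [vanishing, Fin.forall_iff]

theorem isClosed_vanishing (c : unitInterval) (n : ℕ) :
    IsClosed (vanishing M c n : Set (D M)) := by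
  have : (vanishing M c n : Set (D M)) = ⋂ k : Fin n, derivAt c k ⁻¹' {0} := by
    ext f
    simp [mem_vanishing, Fin.forall_iff]
  rw [this]
  exact isClosed_iInter fun k => isClosed_singleton.preimage (derivAt c k).continuous

theorem mem_vanishing_succ {c : unitInterval} {n : ℕ} {f : D M} :
    f ∈ vanishing M c (n + 1) ↔ f ∈ vanishing M c n ∧ derivAt c n f = 0 := by
  simp only [mem_vanishing]
  exact Nat.forall_lt_succ_right

theorem coeSub_pow_mem_vanishing (c : unitInterval) (n : ℕ) :
    coeSub M c ^ n ∈ vanishing M c n :=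
  mem_vanishing.2 fun k hk => by rw [derivAt_coeSub_pow, if_neg hk.ne]

theorem coeSub_pow_notMem_vanishing (c : unitInterval) (n : ℕ) :
    coeSub M c ^ n ∉ vanishing M c (n + 1) := fun h => by
  have h1 := mem_vanishing.1 h n (Nat.lt_succ_self n)
  rw [derivAt_coeSub_pow, if_pos rfl] at h1
  exact Nat.factorial_ne_zero n (by exact_mod_cast h1)

theorem vanishing_succ_lt (c : unitInterval) (n : ℕ) :
    vanishing M c (n + 1) < vanishing M c n :=
  lt_of_le_of_ne (fun _ hf => (mem_vanishing_succ.1 hf).1) fun h =>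
    coeSub_pow_notMem_vanishing c n (h ▸ coeSub_pow_mem_vanishing (M := M) c n)

instance (c : unitInterval) (n : ℕ) : FiniteDimensional ℂ (D M ⧸ vanishing M c n) := by
  let J : D M →ₗ[ℂ] (Fin n → ℂ) := LinearMap.pi fun k => (derivAt (M := M) c k : D M →ₗ[ℂ] ℂ)
  have hJ : vanishing M c n = LinearMap.ker J := by rw [LinearMap.ker_pi]; rfl
  rw [hJ]
  exact (LinearMap.quotKerEquivRange J).symm.finiteDimensional

end D

/-! ### Action of T on the filtration, and spectral values -/

section Endomorphism

open Set D

variable {M : WeightSequence} {φ : unitInterval → unitInterval} {T : D M →ₐ[ℂ] D M}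

/-- φ is the real part of the image under T of the coordinate function. -/
theorem contDiffOn_of_comp (hTφ : ∀ (f : D M) (x : unitInterval), (T f) x = f (φ x)) :
    ContDiffOn ℝ ∞ (ext fun t => (φ t : ℝ)) (Icc 0 1) := by
  have h : ContDiffOn ℝ ∞ (ext (T (coeSub M 0))) (Icc 0 1) := (T (coeSub M 0)).memD.1
  refine (Complex.reCLM.contDiff.comp_contDiffOn h).congr fun t ht => ?_
  simp [ext_apply _ ht, hTφ, coeSub_apply]

theorem hasDerivWithinAt_selfMapDeriv
    (hTφ : ∀ (f : D M) (x : unitInterval), (T f) x = f (φ x)) (x : unitInterval) :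
    HasDerivWithinAt (ext fun t => (φ t : ℝ)) (selfMapDeriv φ x) (Icc 0 1) x :=
  ((contDiffOn_of_comp hTφ).differentiableOn (by simp) x x.2).hasDerivWithinAt

theorem continuous_of_comp (hTφ : ∀ (f : D M) (x : unitInterval), (T f) x = f (φ x)) :
    Continuous φ := by
  have h := continuousOn_iff_continuous_domRestrict.1 (contDiffOn_of_comp hTφ).continuousOn
  refine continuous_induced_rng.2 (h.congr fun x => ?_)
  exact ext_apply _ x.2

theorem derivAt_comp (hTφ : ∀ (f : D M) (x : unitInterval), (T f) x = f (φ x))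
    {c : unitInterval} (hc : φ c = c) {n : ℕ} {f : D M} (hf : f ∈ vanishing M c n) :
    derivAt c n (T f) = (selfMapDeriv φ c : ℂ) ^ n * derivAt c n f := by
  have hmap : MapsTo (ext fun t => (φ t : ℝ)) (Icc 0 1) (Icc 0 1) := fun t ht => by
    rw [ext_apply _ ht]
    exact (φ _).2
  have heq : EqOn (ext (T f)) (ext f ∘ ext fun t => (φ t : ℝ)) (Icc 0 1) := fun t ht => by
    rw [Function.comp, ext_apply _ ht, ext_apply _ (hmap ht), hTφ]
    refine congrArg _ ?_
    exact Subtype.ext (ext_apply (fun t => (φ t : ℝ)) ht).symm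
  rw [derivAt_apply, nthDeriv, iteratedDerivWithin_congr heq c.2,
    iteratedDerivWithin_comp_of_fixed (uniqueDiffOn_Icc zero_lt_one) (contDiffOn_of_comp hTφ)
      hmap c.2 _ n f.memD.1 fun k hk => mem_vanishing.1 hf k hk]
  · rfl
  · rw [ext_apply _ c.2]
    exact congrArg Subtype.val hc

theorem sub_smul_mem_vanishing (hTφ : ∀ (f : D M) (x : unitInterval), (T f) x = f (φ x))
    {c : unitInterval} (hc : φ c = c) {n : ℕ} {f : D M} (hf : f ∈ vanishing M c n) :
    T f - (selfMapDeriv φ c : ℂ) ^ n • f ∈ vanishing M c (n + 1) := by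
  refine mem_vanishing_succ.2 ⟨Submodule.sub_mem _ (mem_vanishing.2 fun k hk => ?_)
    (Submodule.smul_mem _ _ hf), ?_⟩
  · rw [derivAt_comp hTφ hc (mem_vanishing.2 fun j hj => mem_vanishing.1 hf j (hj.trans hk)),
      mem_vanishing.1 hf k hk, mul_zero]
  · rw [map_sub, map_smul, derivAt_comp hTφ hc hf, smul_eq_mul, sub_self]

theorem abs_selfMapDeriv_lt_one (hTφ : ∀ (f : D M) (x : unitInterval), (T f) x = f (φ x))
    (hT : IsCompactOperator T.toLinearMap) {c : unitInterval} (hc : φ c = c) :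
    |selfMapDeriv φ c| < 1 := by
  by_contra hlt
  rw [not_lt] at hlt
  refine false_of_isCompactOperator_of_chain
    (T := ContinuousLinearMap.mkOfIsCompactOperator hT) hT
    (isClosed_vanishing c) (vanishing_succ_lt c) one_pos
    fun n => ⟨(selfMapDeriv φ c : ℂ) ^ n, ?_, fun f hf => sub_smul_mem_vanishing hTφ hc hf⟩
  rw [norm_pow, Complex.norm_real, Real.norm_eq_abs]
  exact one_le_pow₀ hlt

/-- If z - T were invertible, it would induce a surjective, hence injective, map on the
finite-dimensional quotient by `vanishing M c (n + 1)`. But it kills the nonzero class of (x - c)^n.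
-/
theorem pow_mem_spectrum (hTφ : ∀ (f : D M) (x : unitInterval), (T f) x = f (φ x))
    (hT : IsCompactOperator T.toLinearMap) {c : unitInterval} (hc : φ c = c) (n : ℕ) :
    (selfMapDeriv φ c : ℂ) ^ n ∈ spectrum ℂ (ContinuousLinearMap.mkOfIsCompactOperator hT) := by
  intro hu
  set z : ℂ := (selfMapDeriv φ c : ℂ) ^ n
  set A : D M →L[ℂ] D M :=
    algebraMap ℂ (D M →L[ℂ] D M) z - ContinuousLinearMap.mkOfIsCompactOperator hT with hA
  have hApp : ∀ f, A f = z • f - T f := fun f => rfl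
  have hsurj : Function.Surjective A := by
    obtain ⟨u, hu⟩ := spectrum.mem_resolventSet_iff.1 hu
    intro g
    refine ⟨(u⁻¹ : (D M →L[ℂ] D M)ˣ).val g, ?_⟩
    have h1 : u.val * (u⁻¹ : (D M →L[ℂ] D M)ˣ).val = 1 := u.mul_inv
    have h2 := congrArg (fun B : D M →L[ℂ] D M => B g) h1
    rw [hu] at h2
    exact h2
  have hW : vanishing M c (n + 1) ≤ (vanishing M c (n + 1)).comap (A : D M →ₗ[ℂ] D M) :=
    fun f hf => by
      have h1 : T f ∈ vanishing M c (n + 1) := by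
        have := Submodule.add_mem _ ((vanishing_succ_lt c (n + 1)).le
          (sub_smul_mem_vanishing hTφ hc hf))
          (Submodule.smul_mem _ ((selfMapDeriv φ c : ℂ) ^ (n + 1)) hf)
        simpa using this
      exact Submodule.sub_mem _ (Submodule.smul_mem _ z hf) h1
  let B := Submodule.mapQ (vanishing M c (n + 1)) (vanishing M c (n + 1)) (A : D M →ₗ[ℂ] D M) hW
  have hBsurj : Function.Surjective B := by
    intro y
    obtain ⟨g, rfl⟩ := Submodule.Quotient.mk_surjective _ y
    obtain ⟨f, rfl⟩ := hsurj g
    exact ⟨Submodule.Quotient.mk f, rfl⟩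
  have hBinj : Function.Injective B := LinearMap.injective_iff_surjective.2 hBsurj
  have h0 : B (Submodule.Quotient.mk (coeSub M c ^ n)) = 0 := by
    rw [Submodule.mapQ_apply, Submodule.Quotient.mk_eq_zero]
    have := Submodule.neg_mem _
      (sub_smul_mem_vanishing hTφ hc (coeSub_pow_mem_vanishing (M := M) c n))
    rwa [neg_sub] at this
  have h1 := hBinj (h0.trans (map_zero B).symm)
  exact coeSub_pow_notMem_vanishing c n ((Submodule.Quotient.mk_eq_zero _).1 h1)

/-- Invertibility of T would make the identity compact. The identity is induced by φ = id, whose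
derivative at the fixed point 0 is 1, contrary to `abs_selfMapDeriv_lt_one`. -/
theorem zero_mem_spectrum (hT : IsCompactOperator T.toLinearMap) :
    (0 : ℂ) ∈ spectrum ℂ (ContinuousLinearMap.mkOfIsCompactOperator hT) := by
  rw [spectrum.zero_mem_iff]
  rintro ⟨u, hu⟩
  have hid : IsCompactOperator (AlgHom.id ℂ (D M)).toLinearMap := by
    have h1 := hT.clm_comp (u⁻¹ : (D M →L[ℂ] D M)ˣ).val
    have h2 : (u⁻¹ : (D M →L[ℂ] D M)ˣ).val * u.val = 1 := u.inv_mul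
    rw [hu] at h2
    have h3 : ((u⁻¹ : (D M →L[ℂ] D M)ˣ).val ∘ T.toLinearMap) =
        (AlgHom.id ℂ (D M)).toLinearMap :=
      funext fun f => congrArg (fun B : D M →L[ℂ] D M => B f) h2
    rwa [h3] at h1
  have h1 := abs_selfMapDeriv_lt_one (φ := id) (fun f x => rfl) hid (c := 0) rfl
  have h2 : selfMapDeriv id 0 = 1 := by
    refine HasDerivWithinAt.derivWithin ?_ (uniqueDiffOn_Icc zero_lt_one _ (0 : unitInterval).2)
    exact (hasDerivWithinAt_id _ _).congr (fun y hy => ext_apply _ hy)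
      (ext_apply _ (0 : unitInterval).2)
  rw [h2] at h1
  simp at h1

end Endomorphism

end DalesDavie

namespace DalesDavie

/-! ### Uniqueness of the fixed point, and eigenfunctions -/

section FixedPoint

open Set D Filter Topology

variable {M : WeightSequence} {φ : unitInterval → unitInterval} {T : D M →ₐ[ℂ] D M}

theorem exists_fixedPoint (hφ : Continuous φ) : ∃ x, φ x = x := by
  obtain ⟨c, -, hc⟩ := exists_mem_Icc_isFixedPt_of_mapsTo (f := φ) (a := 0) (b := 1)
    hφ.continuousOn zero_le_one fun x _ => ⟨unitInterval.nonneg', unitInterval.le_one'⟩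
  exact ⟨c, hc⟩

/-- Two fixed points at which the derivative is less than `1` are separated by a fixed point at
which it is not; hence a compact endomorphism has at most one fixed point. -/
theorem fixedPoint_unique (hTφ : ∀ (f : D M) (x : unitInterval), (T f) x = f (φ x))
    (hT : IsCompactOperator T.toLinearMap) {a b : unitInterval} (ha : φ a = a) (hb : φ b = b) :
    a = b := by
  wlog hab : a < b generalizing a b
  · rcases lt_trichotomy a b with h | h | h
    · exact this ha hb h
    · exact h
    · exact (this hb ha h).symm
  exfalso
  set Φ : ℝ → ℝ := ext fun t => (φ t : ℝ) with hΦ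
  have hΦval : ∀ x : unitInterval, Φ x = φ x := fun x => ext_apply _ x.2
  have hsub : Icc (a : ℝ) b ⊆ Icc 0 1 := Icc_subset_Icc a.2.1 b.2.2
  have hderiv : ∀ t ∈ Icc (0 : ℝ) 1, HasDerivWithinAt Φ (derivWithin Φ (Icc 0 1) t) (Icc 0 1) t :=
    fun t ht => hasDerivWithinAt_selfMapDeriv hTφ ⟨t, ht⟩
  have hlt : ∀ t ∈ Icc (0 : ℝ) 1, Φ t = t → derivWithin Φ (Icc 0 1) t < 1 := fun t ht h =>
    (abs_lt.1 (abs_selfMapDeriv_lt_one hTφ hT (c := ⟨t, ht⟩)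
      (Subtype.ext ((hΦval ⟨t, ht⟩).symm.trans h)))).2
  -- Comparison with the identity: the derivative bound is required only where Φ t = t, that is, at
  -- fixed points.
  have hle : ∀ ⦃t⦄, t ∈ Icc (a : ℝ) b → Φ t ≤ t := by
    refine image_le_of_deriv_right_lt_deriv_boundary' (B' := fun _ => 1)
      (f' := derivWithin Φ (Icc 0 1))
      (fun t ht => ((hderiv t (hsub ht)).continuousWithinAt).mono hsub) (fun t ht => ?_) ?_
      continuousOn_id (fun t _ => hasDerivWithinAt_id _ _)
      (fun t ht h => hlt t (hsub (Ico_subset_Icc_self ht)) h)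
    · exact (hderiv t (hsub (Ico_subset_Icc_self ht))).mono_of_mem_nhdsWithin
        (Icc_mem_nhdsGE_of_mem ⟨a.2.1.trans ht.1, ht.2.trans_le b.2.2⟩)
    · rw [hΦval, ha]
  have hab' : (a : ℝ) < b := hab
  have hΦb : Φ b = b := by rw [hΦval, hb]
  -- Just to the left of b, slope below 1 gives Φ t > t, against `hle`.
  have hslope := ((hderiv b b.2).mono (Ioo_subset_Icc_self.trans hsub)).limsup_slope_le'
    (fun h => lt_irrefl _ h.2) (hlt b b.2 hΦb)
  have : (𝓝[Ioo (a : ℝ) b] (b : ℝ)).NeBot := right_nhdsWithin_Ioo_neBot hab'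
  obtain ⟨t, hts, ht⟩ := (hslope.and self_mem_nhdsWithin).exists
  rw [slope_def_field, hΦb, div_lt_iff_of_neg (sub_neg.2 ht.2), one_mul] at hts
  linarith [hle (Ioo_subset_Icc_self ht)]

instance : LocallyConnectedSpace unitInterval := by
  refine locallyConnectedSpace_of_connected_bases (fun x ε => Metric.ball x ε)
    (fun _ ε => 0 < ε) (fun x => Metric.nhds_basis_ball) fun x ε _ => ?_
  have h : Metric.ball x ε = Subtype.val ⁻¹' Metric.ball (x : ℝ) ε := rfl
  have h2 : (Metric.ball (x : ℝ) ε).OrdConnected := by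
    rw [Real.ball_eq_Ioo]
    exact ordConnected_Ioo
  rw [h]
  exact (h2.preimage_mono (Subtype.mono_coe _)).isPreconnected

/-- Suppose that `φ ∘ φ` has no fixed point besides `x₀`. A solution of `f ∘ φ = μ f` with `μ ≠ 0`
which vanishes near `x₀` is zero. -/
theorem eq_zero_of_eventually_eq_zero (hφ : Continuous φ) {x₀ : unitInterval} (hx₀ : φ x₀ = x₀)
    (huniq : ∀ x, φ (φ x) = x → x = x₀) {f : unitInterval → ℂ} (hf : Continuous f) {μ : ℂ}
    (hμ : μ ≠ 0) (hfφ : ∀ x, f (φ x) = μ * f x) (h0 : ∀ᶠ x in 𝓝 x₀, f x = 0) (x : unitInterval) :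
    f x = 0 := by
  set Z : Set unitInterval := f ⁻¹' {0} with hZ
  set C := connectedComponentIn Z x₀ with hC
  have hx₀Z : x₀ ∈ Z := h0.self_of_nhds
  have hx₀C : x₀ ∈ C := mem_connectedComponentIn hx₀Z
  have hCZ : C ⊆ Z := connectedComponentIn_subset _ _
  have hpre : IsPreconnected C := isPreconnected_connectedComponentIn
  have hclosed : IsClosed C := by
    refine isClosed_of_closure_subset ?_
    exact hpre.closure.subset_connectedComponentIn (subset_closure hx₀C)
      ((isClosed_singleton.preimage hf).closure_subset_iff.2 hCZ)
  have hnhds : ∀ c ∈ C, Z ∈ 𝓝 c → C ∈ 𝓝 c := fun c hc h => by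
    rw [hC, connectedComponentIn_eq hc]
    exact connectedComponentIn_mem_nhds h
  have hmap : ∀ c ∈ C, φ c ∈ C := fun c hc => by
    have h1 : φ '' C ⊆ C := (hpre.image φ hφ.continuousOn).subset_connectedComponentIn
      ⟨x₀, hx₀C, hx₀⟩ (by
        rintro _ ⟨y, hy, rfl⟩
        have : f y = 0 := hCZ hy
        simp [hZ, hfφ, this])
    exact h1 ⟨c, hc, rfl⟩
  -- If f vanishes near φ c, then μ f = f ∘ φ vanishes near c.
  have hback : ∀ c ∈ C, C ∈ 𝓝 (φ c) → C ∈ 𝓝 c := fun c hc h => by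
    refine hnhds c hc (mem_of_superset (hφ.continuousAt h) fun y hy => ?_)
    have h1 : f (φ y) = 0 := hCZ hy
    rw [hfφ] at h1
    exact (mul_eq_zero.1 h1).resolve_left hμ
  have hmid : ∀ p ∈ C, ∀ q ∈ C, ∀ r, p < r → r < q → C ∈ 𝓝 r := fun p hp q hq r hpr hrq =>
    mem_of_superset (Icc_mem_nhds hpr hrq) (hpre.ordConnected.out hp hq)
  -- The orbit of a non-interior point p of C stays in C and, by `hback`, away from its interior.
  -- With no 2-cycles and no fixed point other than x₀, the points p, φ p, φ (φ p) are distinct, so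
  -- one lies strictly between the others and is interior to the interval C.
  have hopen : IsOpen C := by
    refine isOpen_iff_mem_nhds.2 fun p hp => by_contra fun hpn => ?_
    have hx₀n : C ∈ 𝓝 x₀ := hnhds x₀ hx₀C h0
    have hne : ∀ y, C ∉ 𝓝 y → φ y ≠ y ∧ φ (φ y) ≠ y := fun y hy => by
      have hy0 : y ≠ x₀ := fun h => hy (h ▸ hx₀n)
      exact ⟨fun h => hy0 (huniq y (by rw [h, h])), fun h => hy0 (huniq y h)⟩
    have hq := hmap p hp
    have hqn : C ∉ 𝓝 (φ p) := fun h => hpn (hback p hp h)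
    have hr := hmap _ hq
    have hrn : C ∉ 𝓝 (φ (φ p)) := fun h => hqn (hback _ hq h)
    have h1 := (hne p hpn).1
    have h2 := (hne p hpn).2
    have h3 := (hne _ hqn).1
    rcases lt_or_gt_of_ne h1 with h1 | h1 <;> rcases lt_or_gt_of_ne h2 with h2 | h2 <;>
      rcases lt_or_gt_of_ne h3 with h3 | h3
    all_goals first
      | exact hpn (hmid _ hq _ hr _ ‹_› ‹_›)
      | exact hpn (hmid _ hr _ hq _ ‹_› ‹_›)
      | exact hqn (hmid _ hp _ hr _ ‹_› ‹_›)
      | exact hqn (hmid _ hr _ hp _ ‹_› ‹_›)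
      | exact hrn (hmid _ hp _ hq _ ‹_› ‹_›)
      | exact hrn (hmid _ hq _ hp _ ‹_› ‹_›)
  have huniv : C = univ := IsClopen.eq_univ ⟨hclosed, hopen⟩ ⟨x₀, hx₀C⟩
  exact hCZ (huniv ▸ mem_univ x)

/-- An eigenfunction that is flat at an attracting fixed point vanishes near that point. -/
theorem eventually_eq_zero_of_flat (hTφ : ∀ (f : D M) (x : unitInterval), (T f) x = f (φ x))
    {c : unitInterval} (hc : φ c = c) (hlt : |selfMapDeriv φ c| < 1) {f : D M} {μ : ℂ}
    (hμ : μ ≠ 0) (hf : T f = μ • f) (hflat : ∀ n, derivAt c n f = 0) :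
    ∀ᶠ x in 𝓝 c, f x = 0 := by
  -- ρ is a contraction rate for φ near c, and N is chosen with ρ^N < |μ|. Then |μ|^k |f x| = |f
  -- (φ^k x)| ≤ ρ^(kN) for all k forces f x = 0.
  obtain ⟨ρ, hρ, hρ1⟩ := exists_between hlt
  have hρ0 : 0 ≤ ρ := (abs_nonneg _).trans hρ.le
  obtain ⟨N, hN⟩ := exists_pow_lt_of_lt_one (norm_pos_iff.2 hμ) hρ1
  have hfφ : ∀ x, f (φ x) = μ * f x := fun x => by
    rw [← hTφ, hf]
    rfl
  have h1 := (hasDerivWithinAt_selfMapDeriv hTφ c).limsup_norm_slope_le hρ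
  -- Flatness kills the Taylor polynomial, leaving only the remainder o(|t - c|^N).
  have h2 : ∀ᶠ t in 𝓝[Icc (0 : ℝ) 1] (c : ℝ), ‖ext f t‖ ≤ 1 * ‖(t - c) ^ N‖ := by
    have ht := taylor_isLittleO (n := N) (convex_Icc (0 : ℝ) 1) c.2
      (f.memD.1.of_le (by exact_mod_cast le_top))
    filter_upwards [ht.bound one_pos] with t ht
    have h0 : taylorWithinEval (ext f) N (Icc 0 1) c t = 0 := by
      rw [taylor_within_apply]
      refine Finset.sum_eq_zero fun k _ => ?_
      have : iteratedDerivWithin k (ext f) (Icc 0 1) c = 0 := hflat k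
      rw [this, smul_zero]
    rwa [h0, sub_zero] at ht
  obtain ⟨ε, hε, hε'⟩ := Metric.mem_nhdsWithin_iff.1 (h1.and h2)
  have hstep : ∀ x : unitInterval, |(x : ℝ) - c| < ε →
      |(φ x : ℝ) - c| ≤ ρ * |(x : ℝ) - c| ∧ ‖f x‖ ≤ |(x : ℝ) - c| ^ N := fun x hx => by
    obtain ⟨h3, h4⟩ := hε' ⟨by simpa [Real.dist_eq] using hx, x.2⟩
    simp only [ext_apply _ x.2, ext_apply _ c.2, Subtype.coe_eta, hc, Real.norm_eq_abs, one_mul,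
      norm_pow] at h3 h4
    refine ⟨?_, h4⟩
    rcases eq_or_ne (x : ℝ) c with h | h
    · have hxc : x = c := Subtype.ext h
      simp [hxc, hc]
    · have hpos : 0 < |(x : ℝ) - c| := abs_pos.2 (sub_ne_zero.2 h)
      rw [inv_mul_lt_iff₀ hpos, mul_comm] at h3
      exact h3.le
  have hnear : ∀ᶠ x : unitInterval in 𝓝 c, |(x : ℝ) - c| < ε := by
    filter_upwards [Metric.ball_mem_nhds c hε] with x hx
    exact hx
  filter_upwards [hnear] with x hx
  have hiter : ∀ k : ℕ, |(φ^[k] x : ℝ) - c| ≤ ρ ^ k * |(x : ℝ) - c| := fun k => by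
    induction k with
    | zero => simp
    | succ k ih =>
      have hk : |(φ^[k] x : ℝ) - c| < ε :=
        (ih.trans (mul_le_of_le_one_left (abs_nonneg _) (pow_le_one₀ hρ0 hρ1.le))).trans_lt hx
      rw [Function.iterate_succ_apply', pow_succ', mul_assoc]
      exact (hstep _ hk).1.trans (mul_le_mul_of_nonneg_left ih hρ0)
  have hpow : ∀ k : ℕ, f (φ^[k] x) = μ ^ k * f x := fun k => by
    induction k with
    | zero => simp
    | succ k ih => rw [Function.iterate_succ_apply', hfφ, ih, pow_succ', mul_assoc]
  have hx1 : |(x : ℝ) - c| ≤ 1 := abs_le.2 ⟨by linarith [x.2.1, c.2.2], by linarith [x.2.2, c.2.1]⟩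
  have hbound : ∀ k : ℕ, ‖f x‖ ≤ (ρ ^ N / ‖μ‖) ^ k := fun k => by
    have hle : |(φ^[k] x : ℝ) - c| ≤ ρ ^ k :=
      (hiter k).trans (mul_le_of_le_one_right (pow_nonneg hρ0 k) hx1)
    have hk : |(φ^[k] x : ℝ) - c| < ε :=
      ((hiter k).trans (mul_le_of_le_one_left (abs_nonneg _)
        (pow_le_one₀ hρ0 hρ1.le))).trans_lt hx
    have h3 := (hstep _ hk).2.trans (pow_le_pow_left₀ (abs_nonneg _) hle N)
    rw [hpow, norm_mul, norm_pow] at h3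
    rw [div_pow, le_div_iff₀ (pow_pos (norm_pos_iff.2 hμ) k), ← pow_mul, mul_comm N k, pow_mul,
      mul_comm]
    exact h3
  have hlim : Tendsto (fun k : ℕ => (ρ ^ N / ‖μ‖) ^ k) atTop (𝓝 0) :=
    tendsto_pow_atTop_nhds_zero_of_lt_one (by positivity)
      ((div_lt_one (norm_pos_iff.2 hμ)).2 hN)
  exact norm_le_zero_iff.1 (ge_of_tendsto' hlim hbound)

theorem D.continuous_coe (f : D M) : Continuous (f : unitInterval → ℂ) := by
  have h := continuousOn_iff_continuous_domRestrict.1 (ContDiffOn.continuousOn f.memD.1)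
  exact h.congr fun x => ext_apply _ x.2

theorem eq_pow_of_hasEigenvalue (hTφ : ∀ (f : D M) (x : unitInterval), (T f) x = f (φ x))
    (hT : IsCompactOperator T.toLinearMap) {c : unitInterval} (hc : φ c = c) {f : D M} {μ : ℂ}
    (hμ : μ ≠ 0) (hf : T f = μ • f) (hf0 : f ≠ 0) :
    ∃ n : ℕ, μ = (selfMapDeriv φ c : ℂ) ^ n := by
  classical
  by_cases hflat : ∀ n, derivAt c n f = 0
  · exfalso
    have hTT : IsCompactOperator (T.comp T).toLinearMap :=
      hT.clm_comp (ContinuousLinearMap.mkOfIsCompactOperator hT)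
    -- Excludes 2-cycles: T ∘ T is a compact endomorphism induced by φ ∘ φ, so uniqueness of fixed
    -- points applies to it.
    have huniq : ∀ x, φ (φ x) = x → x = c := fun x hx =>
      fixedPoint_unique (φ := φ ∘ φ) (T := T.comp T)
        (fun g y => (hTφ (T g) y).trans (hTφ g (φ y))) hTT hx (by simp [hc])
    refine hf0 (Subtype.ext (funext fun x => ?_))
    refine eq_zero_of_eventually_eq_zero (continuous_of_comp hTφ) hc huniq f.continuous_coe hμ
      (fun x => ?_) (eventually_eq_zero_of_flat hTφ hc (abs_selfMapDeriv_lt_one hTφ hT hc) hμ hf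
        hflat) x
    rw [← hTφ, hf]
    rfl
  · have hex : ∃ n, derivAt c n f ≠ 0 := not_forall.1 hflat
    have hmem : f ∈ vanishing M c (Nat.find hex) :=
      mem_vanishing.2 fun k hk => not_not.1 (Nat.find_min hex hk)
    have h1 := derivAt_comp hTφ hc hmem
    rw [hf, map_smul, smul_eq_mul] at h1
    exact ⟨_, mul_right_cancel₀ (Nat.find_spec hex) h1⟩

end FixedPoint

end DalesDavie

theorem theorem2p4 (M : DalesDavie.WeightSequence) (φ : unitInterval → unitInterval)
    (T : DalesDavie.D M →ₐ[ℂ] DalesDavie.D M)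
    (hTφ : ∀ (f : DalesDavie.D M) (x : unitInterval), (T f) x = f (φ x))
    (hT : IsCompactOperator T.toLinearMap) :
    (∃! x₀ : unitInterval, φ x₀ = x₀) ∧
    ∀ x₀ : unitInterval, φ x₀ = x₀ →
      spectrum ℂ (ContinuousLinearMap.mkOfIsCompactOperator hT) =
        {z : ℂ | ∃ n : ℕ, 1 ≤ n ∧ z = (DalesDavie.selfMapDeriv φ x₀ : ℂ) ^ n} ∪ {0, 1} := by
  open DalesDavie in
  refine ⟨?_, fun c hc => Set.Subset.antisymm (fun μ hμ => ?_) ?_⟩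
  · obtain ⟨c, hc⟩ := exists_fixedPoint (continuous_of_comp hTφ)
    exact ⟨c, hc, fun y hy => fixedPoint_unique hTφ hT hy hc⟩
  · rcases eq_or_ne μ 0 with rfl | hμ0
    · exact Or.inr (Or.inl rfl)
    obtain ⟨f, hf⟩ := (hasEigenvalue_of_mem_spectrum
      (T := ContinuousLinearMap.mkOfIsCompactOperator hT) hT hμ0 hμ).exists_hasEigenvector
    obtain ⟨n, hn⟩ := eq_pow_of_hasEigenvalue hTφ hT hc hμ0 hf.apply_eq_smul hf.2
    -- Exponent 0 gives the eigenvalue 1, which the target set lists separately.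
    rcases n with _ | n
    · exact Or.inr (Or.inr (by simpa using hn))
    · exact Or.inl ⟨n + 1, Nat.succ_le_succ n.zero_le, hn⟩
  · rintro z (⟨n, -, rfl⟩ | rfl | rfl)
    · exact pow_mem_spectrum hTφ hT hc n
    · exact zero_mem_spectrum hT
    · simpa using pow_mem_spectrum hTφ hT hc 0
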